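/- A loop is a set with a binary operation that has a two-sided identity element $1$ and for which the equations $a\cdot x=b$ and $y\cdot a=b$ have unique solutions $x,y$ for all $a,b$. The inner mapping group of a loop $L$ consists of the elements fixing $1$ in the permutation group generated by all left translations $x\mapsto a\cdot x$ and right translations $x\mapsto x\cdot a$; $L$ is automorphic if every inner mapping is an automorphism of $L$. A half-isomorphism between loops $(L,*)$ and $(L',\cdot)$ is a bijection $f:L\to L'$ with $f(x*y)\in\{f(x)\cdot f(y),\,f(y)\cdot f(x)\}$ for all $x,y\in L$; it is special if $f^{-1}:L'\to L$ is also a half-isomorphism. Proposition 4.1. Let $(Q,*)$ and $(Q',\cdot)$ be automorphic loops, and suppose that for all $x,y\in Q'$, $$x\cdot(x\cdot y)=(y\cdot x)\cdot x \quad\text{if and only if}\quad x\cdot y=y\cdot x .$$ Then every half-isomorphism $f:Q\to Q'$ is special. Moreover, $f(x)\cdot f(y)=f(y)\cdot f(x)$ for all $x,y\in Q$ with $x*y=y*x$. -/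

import Mathlib

/-- A loop: a set with a binary operation having a two-sided identity element `1` and such that,
for all `a b`, the equations `a * x = b` and `y * a = b` have unique solutions. -/
class AlgLoop (L : Type*) extends MulOneClass L where
  existsUnique_mul_left : ∀ a b : L, ∃! x : L, a * x = b
  existsUnique_mul_right : ∀ a b : L, ∃! y : L, y * a = b

namespace AlgLoop

/-- The left translation `x ↦ a * x`, as a permutation of the loop. -/
noncomputable def leftTranslation {L : Type*} [AlgLoop L] (a : L) : Equiv.Perm L :=
  Equiv.ofBijective (fun x => a * x)
    ((Function.bijective_iff_existsUnique _).2 (existsUnique_mul_left a))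

/-- The right translation `x ↦ x * a`, as a permutation of the loop. -/
noncomputable def rightTranslation {L : Type*} [AlgLoop L] (a : L) : Equiv.Perm L :=
  Equiv.ofBijective (fun x => x * a)
    ((Function.bijective_iff_existsUnique _).2 (existsUnique_mul_right a))

/-- The multiplication group `Mlt(L)`, generated by all left and right translations. -/
noncomputable def multiplicationGroup (L : Type*) [AlgLoop L] : Subgroup (Equiv.Perm L) :=
  Subgroup.closure (Set.range (rightTranslation (L := L)) ∪ Set.range (leftTranslation (L := L)))

/-- The inner mapping group `Inn(L)`: the elements of `Mlt(L)` that fix the identity element. -/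
noncomputable def innerMappingGroup (L : Type*) [AlgLoop L] : Subgroup (Equiv.Perm L) :=
  multiplicationGroup L ⊓ MulAction.stabilizer (Equiv.Perm L) (1 : L)

/-- A loop is automorphic if every inner mapping is an automorphism of the loop. -/
def IsAutomorphic (L : Type*) [AlgLoop L] : Prop :=
  ∀ φ ∈ innerMappingGroup L, ∀ x y : L, φ (x * y) = φ x * φ y

/-- The condition: `x(xy) = (yx)x` if and only if `xy = yx`, for all `x y`. -/
def SatisfiesCo1 (L : Type*) [AlgLoop L] : Prop :=
  ∀ x y : L, x * (x * y) = (y * x) * x ↔ x * y = y * x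

/-- A half-isomorphism: a bijection `f` with `f (x * y) ∈ {f x * f y, f y * f x}` for all `x y`. -/
structure IsHalfIsomorphism {L L' : Type*} [AlgLoop L] [AlgLoop L'] (f : L → L') : Prop where
  bijective : Function.Bijective f
  map_mul : ∀ x y : L, f (x * y) ∈ ({f x * f y, f y * f x} : Set L')

/-- A half-isomorphism is special if its inverse mapping is also a half-isomorphism. -/
structure IsSpecial {L L' : Type*} [AlgLoop L] [AlgLoop L'] (f : L → L') : Prop
    extends IsHalfIsomorphism f where
  exists_inverse : ∃ g : L' → L,
    Function.LeftInverse g f ∧ Function.RightInverse g f ∧ IsHalfIsomorphism g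

end AlgLoop

namespace AlgLoop

section Basic

variable {L : Type*} [AlgLoop L]

/-! The second claim gives speciality: if `f` preserves commuting, then f(x)f(y) is always f(xy) or
f(yx). For commuting x, y, put a = f(x), b = f(y) and z = x⁻¹(xy). If f preserves the order in both
xy and x⁻¹y, the condition on Q' forces f(z) = a⁻¹(ab). In automorphic loops (xa⁻¹)(ax) and
(xa)(a⁻¹x) both equal (a⁻¹(ax))², so expanding f(z²) in two ways and cancelling makes a, b commute.
Inversion and swapping x, y give the other cases. -/

theorem mul_left_cancel' {a b c : L} (h : a * b = a * c) : b = c :=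
  (existsUnique_mul_left a (a * c)).unique h rfl

theorem mul_right_cancel' {a b c : L} (h : b * a = c * a) : b = c :=
  (existsUnique_mul_right a (c * a)).unique h rfl

theorem exists_mul_left_eq (a b : L) : ∃ x : L, a * x = b := (existsUnique_mul_left a b).exists

/-- The right inverse of an element of a loop. -/
noncomputable def rinv (a : L) : L := (exists_mul_left_eq a 1).choose

theorem mul_rinv (a : L) : a * rinv a = 1 := (exists_mul_left_eq a 1).choose_spec

theorem eq_rinv {a b : L} (h : a * b = 1) : b = rinv a :=
  mul_left_cancel' (h.trans (mul_rinv a).symm)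

theorem leftTranslation_apply (a x : L) : leftTranslation a x = a * x := rfl

theorem leftTranslation_mem (a : L) : leftTranslation a ∈ multiplicationGroup L :=
  Subgroup.subset_closure (Or.inr ⟨a, rfl⟩)

theorem rightTranslation_mem (a : L) : rightTranslation a ∈ multiplicationGroup L :=
  Subgroup.subset_closure (Or.inl ⟨a, rfl⟩)

/-- Conjugation by `a`: the inner mapping `x ↦ a \ (x * a)`. -/
noncomputable def conjMap (a : L) : Equiv.Perm L := (leftTranslation a)⁻¹ * rightTranslation a

/-- The inner mapping `x ↦ (a * b) \ (a * (b * x))`. -/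
noncomputable def leftInner (a b : L) : Equiv.Perm L :=
  (leftTranslation (a * b))⁻¹ * (leftTranslation a * leftTranslation b)

theorem mul_conjMap (a x : L) : a * conjMap a x = x * a :=
  (leftTranslation a).apply_symm_apply (x * a)

theorem mul_leftInner (a b x : L) : a * b * leftInner a b x = a * (b * x) :=
  (leftTranslation (a * b)).apply_symm_apply (a * (b * x))

theorem conjMap_self (a : L) : conjMap a a = a := mul_left_cancel' (mul_conjMap a a)

theorem conjMap_eq_iff {a x : L} : conjMap a x = x ↔ a * x = x * a := by
  constructor
  · intro h
    conv_lhs => rw [← h]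
    exact mul_conjMap a x
  · intro h
    exact mul_left_cancel' ((mul_conjMap a x).trans h.symm)

end Basic

namespace IsAutomorphic

variable {L : Type*} [AlgLoop L]

theorem map_mul (hL : IsAutomorphic L) {φ : Equiv.Perm L} (hφ : φ ∈ multiplicationGroup L)
    (h1 : φ 1 = 1) (x y : L) : φ (x * y) = φ x * φ y :=
  hL φ ⟨hφ, h1⟩ x y

theorem conjMap_mul (hL : IsAutomorphic L) (a x y : L) :
    conjMap a (x * y) = conjMap a x * conjMap a y := by
  refine hL.map_mul
    (mul_mem (inv_mem (leftTranslation_mem a)) (rightTranslation_mem a)) ?_ x y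
  exact conjMap_eq_iff.2 (by simp)

theorem leftInner_one (a b : L) : leftInner a b 1 = 1 :=
  mul_left_cancel' (a := a * b) (by rw [mul_leftInner, mul_one, mul_one])

theorem leftInner_mul (hL : IsAutomorphic L) (a b x y : L) :
    leftInner a b (x * y) = leftInner a b x * leftInner a b y :=
  hL.map_mul (mul_mem (inv_mem (leftTranslation_mem _))
    (mul_mem (leftTranslation_mem a) (leftTranslation_mem b))) (leftInner_one a b) x y

theorem conjMap_rinv (hL : IsAutomorphic L) {a x : L} (h : conjMap a x = x) :
    conjMap a (rinv x) = rinv x := by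
  apply eq_rinv
  have h1 := hL.conjMap_mul a x (rinv x)
  rw [h, mul_rinv] at h1
  rw [← h1, conjMap_eq_iff, mul_one, one_mul]

theorem rinv_mul (hL : IsAutomorphic L) (a : L) : rinv a * a = 1 := by
  rw [← mul_conjMap, hL.conjMap_rinv (conjMap_self a), mul_rinv]

theorem rinv_rinv (hL : IsAutomorphic L) (a : L) : rinv (rinv a) = a :=
  (eq_rinv (hL.rinv_mul a)).symm

theorem flexible (hL : IsAutomorphic L) (a x : L) : a * x * a = a * (x * a) := by
  rw [← mul_conjMap, hL.conjMap_mul, conjMap_self, mul_conjMap]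

theorem commute_rinv (hL : IsAutomorphic L) {a x : L} (h : a * x = x * a) :
    rinv a * x = x * rinv a :=
  (conjMap_eq_iff.1 (hL.conjMap_rinv (conjMap_eq_iff.2 h.symm))).symm

theorem leftInner_rinv (hL : IsAutomorphic L) (a b x : L) :
    leftInner a b (rinv x) = rinv (leftInner a b x) := by
  apply eq_rinv
  rw [← hL.leftInner_mul, mul_rinv, leftInner_one]

theorem leftInner_left (hL : IsAutomorphic L) (a b : L) : leftInner a b a = a :=
  mul_left_cancel' ((mul_leftInner a b a).trans (hL.flexible a b).symm)

/-- Automorphic loops have the antiautomorphic inverse property. -/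
theorem mul_rinv_rev (hL : IsAutomorphic L) (a b : L) : rinv (a * b) = rinv b * rinv a := by
  generalize hp : a * b = p
  obtain ⟨y, rfl⟩ := exists_mul_left_eq p a
  have hb : leftInner p y (rinv y) = b := by
    apply mul_left_cancel' (a := p * y)
    rw [mul_leftInner, mul_rinv, mul_one, hp]
  have hb' : leftInner p y y = rinv b := by
    rw [← hb, hL.leftInner_rinv, hL.rinv_rinv]
  obtain ⟨u, hu⟩ := exists_mul_left_eq y (rinv p)
  have hua : leftInner p y u = rinv (p * y) := by
    apply eq_rinv
    rw [mul_leftInner, hu, mul_rinv]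
  rw [← hb', ← hua, ← hL.leftInner_mul, hu, hL.leftInner_rinv, hL.leftInner_left]

/-- The inner mapping `x ↦ a⁻¹ * (a * x)` is an automorphism. -/
theorem rinv_mul_mul_map_mul (hL : IsAutomorphic L) (a x y : L) :
    rinv a * (a * (x * y)) = rinv a * (a * x) * (rinv a * (a * y)) :=
  hL.map_mul (φ := leftTranslation (rinv a) * leftTranslation a)
    (mul_mem (leftTranslation_mem _) (leftTranslation_mem _))
    (by simp [leftTranslation_apply, hL.rinv_mul]) x y

/-- The inner mapping `x ↦ a * (a⁻¹ * x)` is an automorphism. -/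
theorem mul_rinv_mul_map_mul (hL : IsAutomorphic L) (a x y : L) :
    a * (rinv a * (x * y)) = a * (rinv a * x) * (a * (rinv a * y)) := by
  simpa only [hL.rinv_rinv] using hL.rinv_mul_mul_map_mul (rinv a) x y

theorem mul_rinv_mul (hL : IsAutomorphic L) (a x : L) :
    a * (rinv a * x) = rinv a * (a * x) := by
  have h := hL.mul_rinv_mul_map_mul a a x
  rw [hL.rinv_mul, mul_one] at h
  exact (mul_left_cancel' h).symm

theorem mul_mul_rinv (hL : IsAutomorphic L) (a x : L) :
    x * a * rinv a = rinv a * (a * x) := by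
  -- Automorphisms commute with inversion; expanding the left side by `mul_rinv_rev` moves a to the
  -- right of x.
  have h : rinv (rinv a * (a * rinv x)) = rinv a * (a * x) := by
    symm
    apply eq_rinv
    rw [← hL.rinv_mul_mul_map_mul, hL.rinv_mul, mul_one, hL.rinv_mul]
  rw [← h, ← hL.mul_rinv_mul, hL.mul_rinv_rev, hL.mul_rinv_rev, hL.rinv_rinv, hL.rinv_rinv]

theorem mul_rinv_mul_right (hL : IsAutomorphic L) (a x : L) :
    x * rinv a * a = rinv a * (a * x) := by
  simpa only [hL.rinv_rinv, hL.mul_rinv_mul] using hL.mul_mul_rinv (rinv a) x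

theorem mul_rinv_mul_mul (hL : IsAutomorphic L) (a x : L) :
    x * rinv a * (a * x) = rinv a * (a * x) * (rinv a * (a * x)) := by
  rw [← hL.mul_rinv_mul_right]
  set b := x * rinv a with hb
  have h : leftInner b a x = b * a := by
    rw [← hL.rinv_rinv x, hL.leftInner_rinv, ← hL.rinv_rinv (b * a)]
    congr 1
    apply mul_left_cancel' (a := b * a)
    rw [mul_leftInner, mul_rinv, ← mul_rinv b]
    congr 1
    rw [hb, hL.mul_rinv_rev, hL.rinv_rinv]
  rw [← mul_leftInner, h]

theorem mul_mul_rinv_mul (hL : IsAutomorphic L) (a x : L) :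
    x * a * (rinv a * x) = rinv a * (a * x) * (rinv a * (a * x)) := by
  simpa only [hL.rinv_rinv, hL.mul_rinv_mul] using hL.mul_rinv_mul_mul (rinv a) x

theorem commute_of_rinv_commute (hL : IsAutomorphic L) {a x : L} (h : rinv a * x = x * rinv a) :
    a * x = x * a := by
  simpa only [hL.rinv_rinv] using hL.commute_rinv h

/-- For T = `conjMap a`, a(ax) = (xa)a means T²x = x, and ax = xa means Tx = x. Applying T to the
hypothesis yields T²x = x. -/
theorem commute_of_mul_mul_rinv_eq (hL : IsAutomorphic L) (hco : SatisfiesCo1 L) {a x : L}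
    (h : a * x * rinv a = rinv a * x * a) : a * x = x * a := by
  rw [← hco]
  have h1 : conjMap a (a * x * rinv a) = rinv a * (a * x) := by
    rw [hL.conjMap_mul, hL.conjMap_mul, conjMap_self, mul_conjMap,
      hL.conjMap_rinv (conjMap_self a), hL.mul_mul_rinv]
  have h2 : rinv a * x * a = rinv a * (a * conjMap a x) := by
    rw [← mul_conjMap, hL.conjMap_mul, hL.conjMap_rinv (conjMap_self a), hL.mul_rinv_mul]
  rw [h, h2, hL.conjMap_mul, hL.conjMap_mul, conjMap_self,
    hL.conjMap_rinv (conjMap_self a)] at h1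
  have h3 : conjMap a (conjMap a x) = x := mul_left_cancel' (mul_left_cancel' h1)
  rw [← mul_conjMap a (x * a), ← mul_conjMap a x, hL.conjMap_mul, conjMap_self, h3]

end IsAutomorphic

namespace IsHalfIsomorphism

variable {Q Q' : Type*} [AlgLoop Q] [AlgLoop Q'] {f : Q → Q'}

theorem map_mul_or (hf : IsHalfIsomorphism f) (x y : Q) :
    f (x * y) = f x * f y ∨ f (x * y) = f y * f x := by
  simpa using hf.map_mul x y

theorem map_one (hf : IsHalfIsomorphism f) : f 1 = 1 := by
  apply mul_left_cancel' (a := f 1)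
  have h := hf.map_mul_or 1 1
  rw [or_self, mul_one] at h
  rw [← h, mul_one]

theorem map_rinv (hf : IsHalfIsomorphism f) (hQ' : IsAutomorphic Q') (x : Q) :
    f (rinv x) = rinv (f x) := by
  have h := hf.map_mul_or x (rinv x)
  rw [mul_rinv, hf.map_one] at h
  rcases h with h | h
  · exact eq_rinv h.symm
  · rw [eq_rinv h.symm, hQ'.rinv_rinv]

theorem map_commute_of_map_mul_eq (hf : IsHalfIsomorphism f) (hQ : IsAutomorphic Q)
    (hQ' : IsAutomorphic Q') (hco : SatisfiesCo1 Q') {x y : Q} (hxy : x * y = y * x)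
    (h₁ : f (x * y) = f x * f y) (h₂ : f (rinv x * y) = rinv (f x) * f y) :
    f x * f y = f y * f x := by
  by_contra hne
  have hr : rinv (f x) * f y ≠ f y * rinv (f x) := fun h => hne (hQ'.commute_of_rinv_commute h)
  have hz : f (rinv x * (x * y)) = rinv (f x) * (f x * f y) := by
    have e₁ := hf.map_mul_or (rinv x) (x * y)
    have e₂ := hf.map_mul_or x (rinv x * y)
    rw [h₁, hf.map_rinv hQ'] at e₁
    rw [h₂, hQ.mul_rinv_mul, hQ'.mul_rinv_mul] at e₂
    rcases e₁ with e₁ | e₁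
    · exact e₁
    · rcases e₂ with e₂ | e₂
      · exact e₂
      · exact absurd (hQ'.commute_of_mul_mul_rinv_eq hco (e₁.symm.trans e₂)) hne
  have hsq := hf.map_mul_or (rinv x * (x * y)) (rinv x * (x * y))
  rw [or_self, hz, ← hQ.mul_rinv_mul_mul, ← hQ.commute_rinv hxy] at hsq
  have e := hf.map_mul_or (rinv x * y) (x * y)
  rw [hsq, h₁, h₂] at e
  rcases e with e | e
  -- The square is rewritten to share its right factor with the other side.
  · rw [← hQ'.mul_rinv_mul_mul] at e
    exact hr (mul_right_cancel' e).symm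
  · rw [← hQ'.mul_mul_rinv_mul] at e
    exact hne (mul_right_cancel' e).symm

/-- Passing to x⁻¹, y⁻¹ turns both reversed products into order-preserving ones. -/
theorem map_commute_of_map_rinv_mul_eq (hf : IsHalfIsomorphism f) (hQ : IsAutomorphic Q)
    (hQ' : IsAutomorphic Q') (hco : SatisfiesCo1 Q') {x y : Q} (hxy : x * y = y * x)
    (h₁ : f (x * y) = f y * f x) (h₂ : f (rinv x * y) = f y * rinv (f x)) :
    f x * f y = f y * f x := by
  have h := hf.map_commute_of_map_mul_eq hQ hQ' hco
    (hQ.commute_rinv (hQ.commute_rinv hxy.symm).symm)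
    (by
      rw [← hQ.mul_rinv_rev, hf.map_rinv hQ', ← hxy, h₁, hQ'.mul_rinv_rev, hf.map_rinv hQ',
        hf.map_rinv hQ'])
    (by
      rw [hf.map_rinv hQ', hf.map_rinv hQ', ← hQ'.mul_rinv_rev, ← h₂, ← hf.map_rinv hQ',
        ← hQ.mul_rinv_rev, hQ.commute_rinv hxy])
  rw [hf.map_rinv hQ', hf.map_rinv hQ'] at h
  exact hQ'.commute_of_rinv_commute (hQ'.commute_of_rinv_commute h.symm).symm

theorem map_commute (hf : IsHalfIsomorphism f) (hQ : IsAutomorphic Q)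
    (hQ' : IsAutomorphic Q') (hco : SatisfiesCo1 Q') {x y : Q} (hxy : x * y = y * x) :
    f x * f y = f y * f x := by
  have h₁ := hf.map_mul_or x y
  have h₂ := hf.map_mul_or (rinv x) y
  rw [hf.map_rinv hQ'] at h₂
  -- In the mixed cases, swapping x and y flips the type of xy but not that of x⁻¹y.
  have h₃ : f (rinv y * x) = rinv (f (rinv x * y)) := by
    rw [← hf.map_rinv hQ', hQ.mul_rinv_rev, hQ.rinv_rinv]
  rcases h₁ with h₁ | h₁ <;> rcases h₂ with h₂ | h₂
  · exact hf.map_commute_of_map_mul_eq hQ hQ' hco hxy h₁ h₂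
  · rw [h₂, hQ'.mul_rinv_rev, hQ'.rinv_rinv] at h₃
    exact (hf.map_commute_of_map_rinv_mul_eq hQ hQ' hco hxy.symm (hxy ▸ h₁) h₃).symm
  · rw [h₂, hQ'.mul_rinv_rev, hQ'.rinv_rinv] at h₃
    exact (hf.map_commute_of_map_mul_eq hQ hQ' hco hxy.symm (hxy ▸ h₁) h₃).symm
  · exact hf.map_commute_of_map_rinv_mul_eq hQ hQ' hco hxy h₁ h₂

/-- A half-isomorphism that maps commuting elements to commuting elements is special. -/
theorem isSpecial (hf : IsHalfIsomorphism f)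
    (hc : ∀ x y : Q, x * y = y * x → f x * f y = f y * f x) : IsSpecial f := by
  obtain ⟨g, hgf, hfg⟩ := Function.bijective_iff_has_inverse.1 hf.bijective
  refine ⟨hf, g, hgf, hfg, Function.bijective_iff_has_inverse.2 ⟨f, hfg, hgf⟩, fun u v => ?_⟩
  obtain ⟨x, rfl⟩ := hf.bijective.surjective u
  obtain ⟨y, rfl⟩ := hf.bijective.surjective v
  suffices f x * f y = f (x * y) ∨ f x * f y = f (y * x) by
    rw [hgf, hgf]
    rcases this with h | h <;> simp [h, hgf _]
  by_cases hxy : x * y = y * x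
  · have := hf.map_mul_or x y
    rw [← hc x y hxy, or_self] at this
    exact Or.inl this.symm
  · rcases hf.map_mul_or x y with h | h
    · exact Or.inl h.symm
    · rcases hf.map_mul_or y x with h' | h'
      -- Otherwise xy and yx would have the same image f(y)f(x).
      · exact absurd (hf.bijective.injective (h.trans h'.symm)) hxy
      · exact Or.inr h'.symm

end IsHalfIsomorphism

end AlgLoop

theorem proposition4p1 {Q Q' : Type*} [AlgLoop Q] [AlgLoop Q']
    (hQ : AlgLoop.IsAutomorphic Q) (hQ' : AlgLoop.IsAutomorphic Q')
    (hco1 : AlgLoop.SatisfiesCo1 Q')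
    (f : Q → Q') (hf : AlgLoop.IsHalfIsomorphism f) :
    AlgLoop.IsSpecial f ∧
      ∀ x y : Q, x * y = y * x → f x * f y = f y * f x :=
  ⟨hf.isSpecial fun _ _ => hf.map_commute hQ hQ' hco1, fun _ _ => hf.map_commute hQ hQ' hco1⟩
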